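/- Fix $c\in\mathbb{C}$ and put $g(x,y)=\frac{c}{x-y}$. For $n\ge 1$ let $P=\sum_{i,j=1}^n E_{ij}\otimes E_{ji}$ be the permutation matrix on $\mathbb{C}^n\otimes\mathbb{C}^n$, and denote the matrix $\mathbb{I}+g(x,y)P$ by $R(x,y)$ when $n=3$ and by $r(x,y)$ when $n=2$. Let $\mathcal{H}$ be a complex vector space, $S\subseteq\mathbb{C}$, and let $T(z)=(T_{ij}(z))_{i,j=1}^3$, $z\in S$, be a $3\times3$ matrix of linear operators on $\mathcal{H}$ (the monodromy matrix) satisfying the $RTT$-relation $$R(x,y)\,(T(x)\otimes I)\,(I\otimes T(y))=(I\otimes T(y))\,(T(x)\otimes I)\,R(x,y),\qquad x,y\in S,\ x\neq y.$$ Let $|0\rangle\in\mathcal{H}$ be a vacuum vector: $T_{ii}(z)|0\rangle=\lambda_i(z)|0\rangle$ for $i=1,2,3$ and some functions $\lambda_i$, and $T_{ij}(z)|0\rangle=0$ for $i>j$, for all $z\in S$. Let $a,b\ge 0$ be integers, and let $\bar u=(u_1,\dots,u_a)$ and $\bar v=(v_1,\dots,v_b)$ be families of elements of $S$ with $v_j\ne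 u_k$ for all $j,k$. Let $V_0,V_1,\dots,V_a$ be copies of $\mathbb{C}^2$, let $\mathbb{D}(z)=\begin{pmatrix}T_{22}(z)&T_{23}(z)\\T_{32}(z)&T_{33}(z)\end{pmatrix}$, and let $$\widehat{\mathcal T}^{(a)}_0(z)=\mathbb{D}_0(z)\,r_{0a}(z,u_a)\cdots r_{01}(z,u_1),$$ where $\mathbb{D}_0$ acts in $V_0\otimes\mathcal{H}$ and $r_{0k}$ acts in $V_0\otimes V_k$. Let $\widehat{\mathcal B}^{(a)}(z)$ be the upper right entry of this $2\times2$ matrix with respect to $V_0$; it is an operator on $\mathcal{H}\otimes V_1\otimes\cdots\otimes V_a$. Let $|\Omega^{(a)}\rangle=\binom10\otimes\cdots\otimes\binom10\in V_1\otimes\cdots\otimes V_a$, and let $F_{\beta_1,\dots,\beta_a}\in\mathcal{H}$ ($\beta_k\in\{1,2\}$) be the components of $$\widehat{\mathcal B}^{(a)}(v_1)\cdots\widehat{\mathcal B}^{(a)}(v_b)\;|0\rangle\otimes|\Omega^{(a)}\rangle$$ in the standard basis of $V_1\otimes\cdots\otimes V_a$. The off-shell Bethe vector is $$|\Psi_{a,b}(\bar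 u;\bar v)\rangle=\sum_{\beta_1,\dots,\beta_a=1}^{2}T_{1,\beta_1+1}(u_1)\cdots T_{1,\beta_a+1}(u_a)\,F_{\beta_1,\dots,\beta_a}.$$ Then $|\Psi_{a,b}(\bar u;\bar v)\rangle$ is symmetric in $\bar u$: for every $i=1,\dots,a-1$, $$|\Psi_{a,b}(\bar u;\bar v)\rangle=|\Psi_{a,b}(\bar u;\bar v)\rangle\Big|_{u_i\leftrightarrow u_{i+1}},$$ and hence $|\Psi_{a,b}(\bar u;\bar v)\rangle$ is unchanged under every permutation of $u_1,\dots,u_a$. -/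

import Mathlib

noncomputable section

namespace NestedBethe

open scoped Kronecker

/-- The rational function `g(x, y) = c / (x - y)`. -/
def g (c x y : ℂ) : ℂ := c / (x - y)

/-- The permutation matrix `P = ∑ E_{ij} ⊗ E_{ji}` on `ℂⁿ ⊗ ℂⁿ`. -/
def permMatrix (n : ℕ) : Matrix (Fin n × Fin n) (Fin n × Fin n) ℂ :=
  ∑ i : Fin n, ∑ j : Fin n, Matrix.single i j (1 : ℂ) ⊗ₖ Matrix.single j i (1 : ℂ)

/-- The `gl_n`-invariant `R`-matrix `R(x, y) = I + g(x, y) P` on `ℂⁿ ⊗ ℂⁿ`. -/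
def RMatrix (n : ℕ) (c x y : ℂ) : Matrix (Fin n × Fin n) (Fin n × Fin n) ℂ :=
  1 + g c x y • permMatrix n

section Model

variable {H : Type*} [AddCommGroup H] [Module ℂ H]

/-- A numerical matrix regarded as a matrix with (scalar) operator entries. -/
def toOp (H : Type*) [AddCommGroup H] [Module ℂ H] {m : Type*} (M : Matrix m m ℂ) :
    Matrix m m (Module.End ℂ H) :=
  M.map (algebraMap ℂ (Module.End ℂ H))

/-- The `RTT`-relation
`R(x, y) (T(x) ⊗ I) (I ⊗ T(y)) = (I ⊗ T(y)) (T(x) ⊗ I) R(x, y)` with the `gl_n`-invariant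
`R`-matrix, for all distinct `x`, `y` in the set `S` on which `T` is defined. -/
def SatisfiesRTT {n : ℕ} (c : ℂ) (S : Set ℂ)
    (T : ℂ → Matrix (Fin n) (Fin n) (Module.End ℂ H)) : Prop :=
  ∀ x ∈ S, ∀ y ∈ S, x ≠ y →
    toOp H (RMatrix n c x y) *
        (T x ⊗ₖ (1 : Matrix (Fin n) (Fin n) (Module.End ℂ H))) *
        ((1 : Matrix (Fin n) (Fin n) (Module.End ℂ H)) ⊗ₖ T y) =
      ((1 : Matrix (Fin n) (Fin n) (Module.End ℂ H)) ⊗ₖ T y) *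
        (T x ⊗ₖ (1 : Matrix (Fin n) (Fin n) (Module.End ℂ H))) *
        toOp H (RMatrix n c x y)

/-- `vac` is a vacuum vector: `T_{ii}(z) vac = λ_i(z) vac`, and `T_{ij}(z) vac = 0` for `i > j`. -/
structure IsVacuum {n : ℕ} (S : Set ℂ) (T : ℂ → Matrix (Fin n) (Fin n) (Module.End ℂ H))
    (lam : Fin n → ℂ → ℂ) (vac : H) : Prop where
  diag : ∀ z ∈ S, ∀ i, T z i i vac = lam i z • vac
  lower : ∀ z ∈ S, ∀ i j, j < i → T z i j vac = 0

/-- `V_0 ⊗ V_1 ⊗ ⋯ ⊗ V_a`, with every `V_k = ℂ²`, has the basis indexed by pairs of an index in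
`V_0` and a multi-index in `V_1 ⊗ ⋯ ⊗ V_a`. For a matrix `M` on `ℂ² ⊗ ℂ²` this is `M_{0k}`, which
acts as `M` in `V_0 ⊗ V_k` and as the identity in the other factors. -/
def actOn {a : ℕ} (k : Fin a) (M : Matrix (Fin 2 × Fin 2) (Fin 2 × Fin 2) ℂ) :
    Matrix (Fin 2 × (Fin a → Fin 2)) (Fin 2 × (Fin a → Fin 2)) ℂ :=
  Matrix.of fun p q =>
    if ∀ m, m ≠ k → p.2 m = q.2 m then M (p.1, p.2 k) (q.1, q.2 k) else 0

/-- The monodromy matrix `r_{0a}(z, u_a) ⋯ r_{01}(z, u_1)` of the inhomogeneous chain, where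
`r` is the `gl_2`-invariant `R`-matrix. -/
def chainMonodromy (c : ℂ) {a : ℕ} (u : Fin a → ℂ) (z : ℂ) :
    Matrix (Fin 2 × (Fin a → Fin 2)) (Fin 2 × (Fin a → Fin 2)) ℂ :=
  (List.ofFn fun k : Fin a => actOn k (RMatrix 2 c z (u k))).reverse.prod

/-- The block `𝔻(z)`: the rows and columns 2 and 3 of `T(z)`. -/
def blockD (T : ℂ → Matrix (Fin 3) (Fin 3) (Module.End ℂ H)) (z : ℂ) :
    Matrix (Fin 2) (Fin 2) (Module.End ℂ H) :=
  (T z).submatrix Fin.succ Fin.succ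

/-- The row `𝔹(z) = (T_{12}(z), T_{13}(z))`. -/
def rowB (T : ℂ → Matrix (Fin 3) (Fin 3) (Module.End ℂ H)) (z : ℂ) :
    Fin 2 → Module.End ℂ H :=
  fun β => T z 0 β.succ

/-- The nested monodromy matrix `𝔻_0(z) r_{0a}(z, u_a) ⋯ r_{01}(z, u_1)`, acting in
`V_0 ⊗ V_1 ⊗ ⋯ ⊗ V_a ⊗ H`. -/
def nestedMonodromy (c : ℂ) (T : ℂ → Matrix (Fin 3) (Fin 3) (Module.End ℂ H))
    {a : ℕ} (u : Fin a → ℂ) (z : ℂ) :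
    Matrix (Fin 2 × (Fin a → Fin 2)) (Fin 2 × (Fin a → Fin 2)) (Module.End ℂ H) :=
  (blockD T z ⊗ₖ (1 : Matrix (Fin a → Fin 2) (Fin a → Fin 2) (Module.End ℂ H))) *
    toOp H (chainMonodromy c u z)

/-- The creation operator of the nested monodromy matrix: its upper right entry with respect to
`V_0`, an operator in `V_1 ⊗ ⋯ ⊗ V_a ⊗ H`. -/
def nestedB (c : ℂ) (T : ℂ → Matrix (Fin 3) (Fin 3) (Module.End ℂ H))
    {a : ℕ} (u : Fin a → ℂ) (z : ℂ) :
    Matrix (Fin a → Fin 2) (Fin a → Fin 2) (Module.End ℂ H) :=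
  Matrix.of fun s t => nestedMonodromy c T u z (0, s) (1, t)

/-- The action of a matrix of operators on a column of vectors. -/
def opMulVec {m : Type*} [Fintype m] (M : Matrix m m (Module.End ℂ H)) (x : m → H) : m → H :=
  fun s => ∑ t, M s t (x t)

/-- The vector `vac ⊗ (1,0)ᵀ ⊗ ⋯ ⊗ (1,0)ᵀ`; a vector of `H ⊗ (ℂ²)^{⊗ a}` is given by its
components in `H`. -/
def nestedVacuum (a : ℕ) (vac : H) : (Fin a → Fin 2) → H :=
  Pi.single (fun _ => 0) vac

/-- The components of the vector `B̂(v_1) ⋯ B̂(v_b) (vac ⊗ Ω)`. -/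
def nestedVector (c : ℂ) (T : ℂ → Matrix (Fin 3) (Fin 3) (Module.End ℂ H)) (vac : H)
    {a b : ℕ} (u : Fin a → ℂ) (v : Fin b → ℂ) : (Fin a → Fin 2) → H :=
  opMulVec (List.ofFn fun j : Fin b => nestedB c T u (v j)).prod (nestedVacuum a vac)

/-- The off-shell Bethe vector
`𝔹_1(u_1) ⋯ 𝔹_a(u_a) B̂(v_1) ⋯ B̂(v_b) (vac ⊗ Ω)`, that is,
`∑_{β_1, …, β_a} B_{β_1}(u_1) ⋯ B_{β_a}(u_a) F_{β_1, …, β_a}`. -/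
def betheVector (c : ℂ) (T : ℂ → Matrix (Fin 3) (Fin 3) (Module.End ℂ H)) (vac : H)
    {a b : ℕ} (u : Fin a → ℂ) (v : Fin b → ℂ) : H :=
  ∑ β : Fin a → Fin 2,
    (List.ofFn fun k : Fin a => rowB T (u k) (β k)).prod (nestedVector c T vac u v β)

end Model

end NestedBethe

end

/-! Let `u'` be `u` with `u_i`, `u_{i+1}` exchanged, let `t = g(u_i, u_{i+1})`, and let `P` permute
`V_i` and `V_{i+1}`. The operator `P + t = P r(u_i, u_{i+1})` acts neither on `V_0` nor on the
quantum space. By the Yang-Baxter equation it carries the chain monodromy for `u` into that for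
`u'`, hence each creation operator too (`exchange_mul_chainMonodromy`). Since `P` fixes the nested
vacuum, the components satisfy `(P + t) F(u) = (1 + t) F(u')` (`exchangeVec_nestedVector`).

The first row of the RTT-relation gives `(1 + t) B_α(u_i) B_β(u_{i+1}) = B_β(u_{i+1}) B_α(u_i) + t
B_α(u_{i+1}) B_β(u_i)`: the row of products for `u`, times `1 + t`, is the row for `u'` times `P +
t`. Contracting with `F(u)` gives `(1 + t) Ψ(u) = (1 + t) Ψ(u')` (`smul_betheVector_swap`). If `1 +
t = 0`, the same identity started from `u'` has the factor `1 - t = 2`. Adjacent transpositions then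
generate all permutations. -/

namespace NestedBethe

open scoped Kronecker

/-! ### Local exchange relations inside ordered products. -/

section Products

/-- Intertwining of an ordered product two adjacent factors of which are exchanged. -/
theorem intertwine_reverse_prod {M : Type*} [Monoid M] (q : M) :
    ∀ (a i : ℕ) (hi : i + 1 < a) (f f' : Fin a → M),
      q * (f ⟨i + 1, hi⟩ * f ⟨i, Nat.lt_of_succ_lt hi⟩) =
        f' ⟨i + 1, hi⟩ * f' ⟨i, Nat.lt_of_succ_lt hi⟩ * q →
      (∀ k : Fin a, k.1 ≠ i → k.1 ≠ i + 1 → q * f k = f' k * q) →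
      q * (List.ofFn f).reverse.prod = (List.ofFn f').reverse.prod * q := by
  -- This handles the factors with larger index, to the left of the exchanged pair: reversal puts
  -- the factor of index 0 rightmost.
  have all : ∀ (a : ℕ) (f f' : Fin a → M), (∀ k, q * f k = f' k * q) →
      q * (List.ofFn f).reverse.prod = (List.ofFn f').reverse.prod * q := by
    intro a
    induction a with
    | zero => intro f f' _; simp
    | succ a ih =>
      intro f f' h
      rw [List.ofFn_succ, List.ofFn_succ]
      simp only [List.reverse_cons, List.prod_append, List.prod_singleton]
      rw [← mul_assoc, ih _ (fun k => f' k.succ) fun k => h k.succ, mul_assoc, h 0, mul_assoc]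
  intro a
  induction a with
  | zero => intro i hi; omega
  | succ a ih =>
    intro i hi f f' h2 h
    cases i with
    | zero =>
      obtain ⟨a, rfl⟩ : ∃ m, a = m + 1 := ⟨a - 1, by omega⟩
      rw [List.ofFn_succ, List.ofFn_succ, List.ofFn_succ, List.ofFn_succ]
      simp only [List.reverse_cons, List.prod_append, List.prod_singleton]
      rw [mul_assoc, ← mul_assoc q, all _ _ (fun k => f' k.succ.succ), mul_assoc]
      · have h2' : q * (f (Fin.succ 0) * f 0) = f' (Fin.succ 0) * f' 0 * q := h2
        rw [h2']
        simp only [mul_assoc]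
      · intro k
        exact h _ (by simp) (by simp)
    | succ i =>
      rw [List.ofFn_succ, List.ofFn_succ]
      simp only [List.reverse_cons, List.prod_append, List.prod_singleton]
      rw [← mul_assoc, ih i (by omega) (fun k => f k.succ) (fun k => f' k.succ) h2, mul_assoc,
        h 0 (by simp) (by simp), mul_assoc]
      intro k h3 h4
      exact h k.succ (by simpa using h3) (by simpa using h4)

/-- A linear relation between products of two adjacent factors extends to the ordered products. -/
theorem smul_prod_ofFn {A : Type*} [Ring A] [Algebra ℂ A] (s t : ℂ) :
    ∀ (a i : ℕ) (hi : i + 1 < a) (f f₁ f₂ : Fin a → A),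
      s • (f ⟨i, Nat.lt_of_succ_lt hi⟩ * f ⟨i + 1, hi⟩) =
        f₁ ⟨i, Nat.lt_of_succ_lt hi⟩ * f₁ ⟨i + 1, hi⟩ +
          t • (f₂ ⟨i, Nat.lt_of_succ_lt hi⟩ * f₂ ⟨i + 1, hi⟩) →
      (∀ k : Fin a, k.1 ≠ i → k.1 ≠ i + 1 → f₁ k = f k ∧ f₂ k = f k) →
      s • (List.ofFn f).prod = (List.ofFn f₁).prod + t • (List.ofFn f₂).prod := by
  intro a
  induction a with
  | zero => intro i hi; omega
  | succ a ih =>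
    intro i hi f f₁ f₂ h2 h
    cases i with
    | zero =>
      obtain ⟨a, rfl⟩ : ∃ m, a = m + 1 := ⟨a - 1, by omega⟩
      have h1 : (fun k : Fin a => f₁ k.succ.succ) = fun k => f k.succ.succ :=
        funext fun k => (h k.succ.succ (by simp) (by simp)).1
      have h3 : (fun k : Fin a => f₂ k.succ.succ) = fun k => f k.succ.succ :=
        funext fun k => (h k.succ.succ (by simp) (by simp)).2
      have h2' : s • (f 0 * f (Fin.succ 0)) =
        f₁ 0 * f₁ (Fin.succ 0) + t • (f₂ 0 * f₂ (Fin.succ 0)) := h2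
      simp only [List.ofFn_succ, List.prod_cons, h1, h3]
      simp only [← mul_assoc]
      rw [← smul_mul_assoc, h2', add_mul, smul_mul_assoc]
    | succ i =>
      rw [List.ofFn_succ, List.ofFn_succ, List.ofFn_succ]
      obtain ⟨h1, h3⟩ := h 0 (by simp) (by simp)
      simp only [List.prod_cons]
      rw [h1, h3, ← mul_smul_comm, ih i (by omega) (fun k => f k.succ) (fun k => f₁ k.succ)
        (fun k => f₂ k.succ) h2, mul_add, mul_smul_comm]
      intro k h3 h4
      exact h k.succ (by simpa using h3) (by simpa using h4)

end Products

/-! ### R-matrices as elements of the group algebra of permutations of tensor factors. -/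

section Permutations

variable {a : ℕ}

/-- The permutation of basis vectors that exchanges the factors `V_0` and `V_k`. -/
def flip (k : Fin a) : Equiv.Perm (Fin 2 × (Fin a → Fin 2)) :=
  Function.Involutive.toPerm (fun p => (p.2 k, Function.update p.2 k p.1)) fun p => by simp

/-- The permutation of basis vectors that exchanges the factors `V_i` and `V_j`. -/
def flipInner (i j : Fin a) : Equiv.Perm (Fin 2 × (Fin a → Fin 2)) :=
  Function.Involutive.toPerm (fun p => (p.1, p.2 ∘ Equiv.swap i j)) fun p => by
    ext <;> simp

theorem flip_apply (k : Fin a) (p : Fin 2 × (Fin a → Fin 2)) :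
    flip k p = (p.2 k, Function.update p.2 k p.1) := rfl

theorem flipInner_apply (i j : Fin a) (p : Fin 2 × (Fin a → Fin 2)) :
    flipInner i j p = (p.1, p.2 ∘ Equiv.swap i j) := rfl

/-- `flip k` plays the transposition (0 k) and `flipInner i j` plays (i j); this and the next
relations are conjugations of transpositions. -/
theorem flipInner_mul_flip_left {i j : Fin a} :
    flipInner i j * flip i = flip j * flipInner i j := by
  refine Equiv.ext fun p => Prod.ext ?_ (funext fun m => ?_)
  · simp [flip_apply, flipInner_apply]
  · simp only [Equiv.Perm.mul_apply, flip_apply, flipInner_apply, Function.comp_apply,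
      Function.update_apply, Equiv.swap_apply_def]
    grind

theorem flipInner_mul_flip_right {i j : Fin a} :
    flipInner i j * flip j = flip i * flipInner i j := by
  refine Equiv.ext fun p => Prod.ext ?_ (funext fun m => ?_)
  · simp [flip_apply, flipInner_apply]
  · simp only [Equiv.Perm.mul_apply, flip_apply, flipInner_apply, Function.comp_apply,
      Function.update_apply, Equiv.swap_apply_def]
    grind

theorem flipInner_mul_flip_of_ne {i j k : Fin a} (hi : k ≠ i) (hj : k ≠ j) :
    flipInner i j * flip k = flip k * flipInner i j := by
  refine Equiv.ext fun p => Prod.ext ?_ (funext fun m => ?_)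
  · simp [flip_apply, flipInner_apply, Equiv.swap_apply_of_ne_of_ne hi hj]
  · simp only [Equiv.Perm.mul_apply, flip_apply, flipInner_apply, Function.comp_apply,
      Function.update_apply, Equiv.swap_apply_def]
    grind

theorem flip_mul_flip {i j : Fin a} (hij : i ≠ j) :
    flip i * flip j = flip j * flipInner i j := by
  refine Equiv.ext fun p => Prod.ext ?_ (funext fun m => ?_)
  · simp [flip_apply, flipInner_apply, hij]
  · simp only [Equiv.Perm.mul_apply, flip_apply, flipInner_apply, Function.comp_apply,
      Function.update_apply, Equiv.swap_apply_def]
    grind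

theorem flipInner_mul_self (i j : Fin a) : flipInner i j * flipInner i j = 1 := by
  refine Equiv.ext fun p => Prod.ext rfl (funext fun m => ?_)
  simp [flipInner_apply]

theorem permMatrix_apply (n : ℕ) (p q : Fin n × Fin n) :
    permMatrix n p q = if p.1 = q.2 ∧ p.2 = q.1 then 1 else 0 := by
  simp only [permMatrix, Matrix.sum_apply, Matrix.kroneckerMap_apply, Matrix.single_apply]
  rw [Finset.sum_eq_single p.1, Finset.sum_eq_single p.2]
  · by_cases h1 : p.1 = q.2 <;> by_cases h2 : p.2 = q.1 <;> simp [h1, h2]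
  · intro b _ hb; simp [hb]
  · simp
  · intro b _ hb; simp [hb]
  · simp

/-- Reduces Yang-Baxter to relations between permutations and one scalar identity. -/
theorem actOn_RMatrix (c x y : ℂ) (k : Fin a) :
    actOn k (RMatrix 2 c x y) = 1 + g c x y • (flip k).permMatrix ℂ := by
  ext p q
  have h1 : (p = q) ↔ (∀ m, m ≠ k → p.2 m = q.2 m) ∧ p.1 = q.1 ∧ p.2 k = q.2 k := by
    constructor
    · rintro rfl; simp
    · rintro ⟨h, h1, h2⟩
      refine Prod.ext h1 (funext fun m => ?_)
      by_cases hm : m = k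
      · rw [hm, h2]
      · exact h m hm
  have h2 : flip k p = q ↔ (∀ m, m ≠ k → p.2 m = q.2 m) ∧ p.1 = q.2 k ∧ p.2 k = q.1 := by
    rw [flip_apply]
    constructor
    · rintro rfl
      simp +contextual
    · rintro ⟨h, h1, h2⟩
      refine Prod.ext h2 (funext fun m => ?_)
      by_cases hm : m = k
      · subst hm; simp [h1]
      · simp [hm, h m hm]
  simp only [actOn, Matrix.of_apply, RMatrix, Matrix.add_apply, Matrix.smul_apply,
    permMatrix_apply, Equiv.Perm.permMatrix, PEquiv.toMatrix_apply, Equiv.toPEquiv_apply,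
    Option.mem_def, Option.some.injEq, Matrix.one_apply, Prod.mk.injEq]
  by_cases h : ∀ m, m ≠ k → p.2 m = q.2 m
  · rw [if_pos h]
    simp only [h2, h1, and_iff_right h]
  · simp only [h2, h1, h, false_and, if_false, smul_zero, add_zero]

end Permutations

/-! ### Yang-Baxter equation and exchange of inhomogeneities in the chain. -/

section Chain

variable {a : ℕ}

/-- Yang-Baxter identity for elements satisfying the relations of transpositions of three points. -/
theorem yangBaxter_of_relations {A : Type*} [Ring A] [Algebra ℂ A] {P P' Q : A} {t s s' : ℂ}
    (hP : Q * P = P' * Q) (hP' : Q * P' = P * Q) (h : P' * P = Q * P') (hQ : Q * Q = 1)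
    (hs : s * s' + t * s' = t * s) :
    (Q + t • 1) * ((1 + s' • P') * (1 + s • P)) =
      (1 + s • P') * (1 + s' • P) * (Q + t • 1) := by
  have e1 : Q * (P' * P) = P' := by rw [h, ← mul_assoc, hQ, one_mul]
  have e2 : P' * P * Q = P := by rw [h, hP', mul_assoc, hQ, mul_one]
  simp only [mul_add, add_mul, mul_one, one_mul, smul_mul_assoc, mul_smul_comm, smul_add,
    smul_smul, e1, e2, ← hP, ← hP', ← h]
  -- Only the coefficients of `P` and `P'` differ on the two sides, and both differences are `hs` up
  -- to sign.
  match_scalars <;> first | ring1 | linear_combination hs | linear_combination -hs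

/-- The exchange operator `P + t` in the factors `V_i ⊗ V_j`. -/
noncomputable def exchange (t : ℂ) (i j : Fin a) :
    Matrix (Fin 2 × (Fin a → Fin 2)) (Fin 2 × (Fin a → Fin 2)) ℂ :=
  (flipInner i j).permMatrix ℂ + t • 1

theorem g_mul_g {c x y z : ℂ} (hxy : x ≠ y) (hx : z ≠ x) (hy : z ≠ y) :
    g c z x * g c z y + g c x y * g c z y = g c x y * g c z x := by
  have h1 := sub_ne_zero.2 hxy
  have h2 := sub_ne_zero.2 hx
  have h3 := sub_ne_zero.2 hy
  unfold g
  field_simp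
  ring

theorem exchange_mul_chainMonodromy (c : ℂ) (u : Fin a → ℂ) (z : ℂ) (i : ℕ) (hi : i + 1 < a)
    (hz : ∀ k, z ≠ u k) (hne : u ⟨i, Nat.lt_of_succ_lt hi⟩ ≠ u ⟨i + 1, hi⟩) :
    exchange (g c (u ⟨i, Nat.lt_of_succ_lt hi⟩) (u ⟨i + 1, hi⟩))
        ⟨i, Nat.lt_of_succ_lt hi⟩ ⟨i + 1, hi⟩ * chainMonodromy c u z =
      chainMonodromy c (u ∘ Equiv.swap (⟨i, Nat.lt_of_succ_lt hi⟩ : Fin a) ⟨i + 1, hi⟩) z *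
        exchange (g c (u ⟨i, Nat.lt_of_succ_lt hi⟩) (u ⟨i + 1, hi⟩))
          ⟨i, Nat.lt_of_succ_lt hi⟩ ⟨i + 1, hi⟩ := by
  unfold chainMonodromy
  apply intertwine_reverse_prod _ a i hi
  · simp only [actOn_RMatrix, Function.comp_apply, Equiv.swap_apply_left,
      Equiv.swap_apply_right, exchange]
    apply yangBaxter_of_relations
    -- Passing to permutation matrices reverses products, so the left and right relations trade
    -- places here.
    · rw [← Matrix.permMatrix_mul, ← Matrix.permMatrix_mul, flipInner_mul_flip_right]
    · rw [← Matrix.permMatrix_mul, ← Matrix.permMatrix_mul, flipInner_mul_flip_left]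
    · rw [← Matrix.permMatrix_mul, ← Matrix.permMatrix_mul, flip_mul_flip (by simp)]
    · rw [← Matrix.permMatrix_mul, flipInner_mul_self, Matrix.permMatrix_one]
    · exact g_mul_g hne (hz _) (hz _)
  · intro k h1 h2
    have h1' : k ≠ ⟨i, Nat.lt_of_succ_lt hi⟩ := fun h => h1 (congrArg Fin.val h)
    have h2' : k ≠ ⟨i + 1, hi⟩ := fun h => h2 (congrArg Fin.val h)
    simp only [actOn_RMatrix, Function.comp_apply, Equiv.swap_apply_of_ne_of_ne h1' h2', exchange]
    have h : (flipInner ⟨i, Nat.lt_of_succ_lt hi⟩ ⟨i + 1, hi⟩).permMatrix ℂ *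
        (flip k).permMatrix ℂ = (flip k).permMatrix ℂ *
          (flipInner ⟨i, Nat.lt_of_succ_lt hi⟩ ⟨i + 1, hi⟩).permMatrix ℂ := by
      rw [← Matrix.permMatrix_mul, ← Matrix.permMatrix_mul, flipInner_mul_flip_of_ne h1' h2']
    simp only [mul_add, add_mul, mul_one, one_mul, smul_mul_assoc, mul_smul_comm, h]
    module

theorem exchange_mul_apply (t : ℂ) (i j : Fin a)
    (M : Matrix (Fin 2 × (Fin a → Fin 2)) (Fin 2 × (Fin a → Fin 2)) ℂ)
    (p q : Fin 2 × (Fin a → Fin 2)) :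
    (exchange t i j * M) p q = M (p.1, p.2 ∘ Equiv.swap i j) q + t * M p q := by
  rw [exchange, add_mul, smul_mul_assoc, one_mul, Matrix.add_apply,
    PEquiv.toMatrix_toPEquiv_mul]
  rfl

theorem mul_exchange_apply (t : ℂ) (i j : Fin a)
    (M : Matrix (Fin 2 × (Fin a → Fin 2)) (Fin 2 × (Fin a → Fin 2)) ℂ)
    (p q : Fin 2 × (Fin a → Fin 2)) :
    (M * exchange t i j) p q = M p (q.1, q.2 ∘ Equiv.swap i j) + t * M p q := by
  rw [exchange, mul_add, mul_smul_comm, mul_one, Matrix.add_apply,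
    PEquiv.mul_toMatrix_toPEquiv]
  rfl

end Chain

/-! ### Exchange operator acting on the nested Bethe vector. -/

section Nested

variable {H : Type*} [AddCommGroup H] [Module ℂ H] {a b : ℕ}

/-- The chain has scalar entries, so relations between chain monodromies transfer coefficientwise,
whatever the block `𝔻` is. -/
theorem nestedB_apply (c : ℂ) (T : ℂ → Matrix (Fin 3) (Fin 3) (Module.End ℂ H))
    (u : Fin a → ℂ) (z : ℂ) (s t : Fin a → Fin 2) :
    nestedB c T u z s t = ∑ p, chainMonodromy c u z (p, s) (1, t) • blockD T z 0 p := by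
  simp only [nestedB, nestedMonodromy, Matrix.of_apply, Matrix.mul_apply, Fintype.sum_prod_type,
    Matrix.kroneckerMap_apply, toOp, Matrix.map_apply]
  refine Finset.sum_congr rfl fun p _ => ?_
  rw [Finset.sum_eq_single s]
  · rw [Matrix.one_apply_eq, mul_one, ← Algebra.commutes, Algebra.smul_def]
  · intro r _ hr
    rw [Matrix.one_apply_ne hr.symm, mul_zero, zero_mul]
  · simp

/-- The action of `P + t` in the factors `V_i ⊗ V_j` on a vector of `H ⊗ (ℂ²)^{⊗ a}`. -/
noncomputable def exchangeVec (t : ℂ) (i j : Fin a) (F : (Fin a → Fin 2) → H) : (Fin a → Fin 2) → H :=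
  fun s => F (s ∘ Equiv.swap i j) + t • F s

theorem sum_comp_swap {M : Type*} [AddCommMonoid M] (i j : Fin a) (f : (Fin a → Fin 2) → M) :
    ∑ s, f (s ∘ Equiv.swap i j) = ∑ s, f s :=
  Fintype.sum_equiv ((Equiv.swap i j).arrowCongr (Equiv.refl (Fin 2))) _ _ fun s => by
    congr 1

theorem comp_swap_comp_swap (i j : Fin a) {α : Type*} (s : Fin a → α) :
    (s ∘ Equiv.swap i j) ∘ Equiv.swap i j = s := by
  ext; simp

/-- The hypothesis is the intertwining `(P + t) N = N' (P + t)` written in entries. -/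
theorem exchangeVec_opMulVec {t : ℂ} {i j : Fin a}
    {N N' : Matrix (Fin a → Fin 2) (Fin a → Fin 2) (Module.End ℂ H)}
    (h : ∀ s r, N (s ∘ Equiv.swap i j) r + t • N s r =
      N' s (r ∘ Equiv.swap i j) + t • N' s r) (F : (Fin a → Fin 2) → H) :
    exchangeVec t i j (opMulVec N F) = opMulVec N' (exchangeVec t i j F) := by
  funext s
  simp only [exchangeVec, opMulVec, map_add, map_smul, Finset.smul_sum,
    Finset.sum_add_distrib]
  rw [← sum_comp_swap i j fun r => N' s r (F (r ∘ Equiv.swap i j))]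
  simp only [comp_swap_comp_swap]
  rw [← Finset.sum_add_distrib, ← Finset.sum_add_distrib]
  refine Finset.sum_congr rfl fun r _ => ?_
  simpa using LinearMap.congr_fun (h s r) (F r)

theorem opMulVec_mul {m : Type*} [Fintype m] (M N : Matrix m m (Module.End ℂ H)) (x : m → H) :
    opMulVec (M * N) x = opMulVec M (opMulVec N x) := by
  funext s
  simp only [opMulVec, Matrix.mul_apply, LinearMap.sum_apply, Module.End.mul_apply, map_sum]
  exact Finset.sum_comm

theorem opMulVec_one {m : Type*} [Fintype m] [DecidableEq m] (x : m → H) :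
    opMulVec (1 : Matrix m m (Module.End ℂ H)) x = x := by
  funext s
  simp only [opMulVec]
  rw [Finset.sum_eq_single s]
  · simp
  · intro r _ hr
    simp [Matrix.one_apply_ne hr.symm]
  · simp

theorem exchangeVec_opMulVec_prod {t : ℂ} {i j : Fin a} :
    ∀ (b : ℕ) (N N' : Fin b → Matrix (Fin a → Fin 2) (Fin a → Fin 2) (Module.End ℂ H))
      (_ : ∀ k s r, N k (s ∘ Equiv.swap i j) r + t • N k s r =
        N' k s (r ∘ Equiv.swap i j) + t • N' k s r) (F : (Fin a → Fin 2) → H),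
      exchangeVec t i j (opMulVec (List.ofFn N).prod F) =
        opMulVec (List.ofFn N').prod (exchangeVec t i j F) := by
  intro b
  induction b with
  | zero => intro N N' _ F; simp [opMulVec_one]
  | succ b ih =>
    intro N N' h F
    rw [List.ofFn_succ, List.ofFn_succ, List.prod_cons, List.prod_cons, opMulVec_mul,
      opMulVec_mul, exchangeVec_opMulVec (h 0), ih _ (fun k => N' k.succ) fun k => h k.succ]

theorem exchangeVec_nestedVacuum (t : ℂ) (i j : Fin a) (vac : H) :
    exchangeVec t i j (nestedVacuum a vac) = (1 + t) • nestedVacuum a vac := by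
  funext s
  have h : nestedVacuum a vac (s ∘ Equiv.swap i j) = nestedVacuum a vac s := by
    have h0 : s ∘ Equiv.swap i j = (fun _ => 0) ↔ s = fun _ => 0 := by
      constructor
      · intro h
        rw [← comp_swap_comp_swap i j s, h]
        rfl
      · rintro rfl
        rfl
    simp only [nestedVacuum, Pi.single_apply, h0]
  rw [exchangeVec, h, Pi.smul_apply, add_smul, one_smul]

theorem opMulVec_smul {m : Type*} [Fintype m] (M : Matrix m m (Module.End ℂ H)) (t : ℂ)
    (x : m → H) : opMulVec M (t • x) = t • opMulVec M x := by
  funext s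
  simp [opMulVec, Finset.smul_sum]

theorem exchangeVec_nestedVector (c : ℂ) (T : ℂ → Matrix (Fin 3) (Fin 3) (Module.End ℂ H))
    (vac : H) (u : Fin a → ℂ) (v : Fin b → ℂ) (i : ℕ) (hi : i + 1 < a)
    (huv : ∀ j k, v j ≠ u k) (hne : u ⟨i, Nat.lt_of_succ_lt hi⟩ ≠ u ⟨i + 1, hi⟩) :
    exchangeVec (g c (u ⟨i, Nat.lt_of_succ_lt hi⟩) (u ⟨i + 1, hi⟩))
        ⟨i, Nat.lt_of_succ_lt hi⟩ ⟨i + 1, hi⟩ (nestedVector c T vac u v) =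
      (1 + g c (u ⟨i, Nat.lt_of_succ_lt hi⟩) (u ⟨i + 1, hi⟩)) •
        nestedVector c T vac
          (u ∘ Equiv.swap (⟨i, Nat.lt_of_succ_lt hi⟩ : Fin a) ⟨i + 1, hi⟩) v := by
  unfold nestedVector
  rw [exchangeVec_opMulVec_prod b _ (fun k => nestedB c T
    (u ∘ Equiv.swap (⟨i, Nat.lt_of_succ_lt hi⟩ : Fin a) ⟨i + 1, hi⟩) (v k)),
    exchangeVec_nestedVacuum, opMulVec_smul]
  intro k s r
  simp only [nestedB_apply, Finset.smul_sum, smul_smul, ← Finset.sum_add_distrib, ← add_smul]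
  refine Finset.sum_congr rfl fun p _ => ?_
  -- The exchange operator preserves the `V_0` index, so the intertwining holds separately for each
  -- `p`, in column 1.
  have h := congrFun₂ (exchange_mul_chainMonodromy c u (v k) i hi (huv k) hne) (p, s) (1, r)
  rw [exchange_mul_apply, mul_exchange_apply] at h
  rw [h]

end Nested

/-! ### RTT-relation for the first row and symmetry of the Bethe vector. -/

section BetheVector

variable {H : Type*} [AddCommGroup H] [Module ℂ H] {a b : ℕ}

theorem toOp_RMatrix_mul_apply {n : ℕ} (c x y : ℂ)
    (M : Matrix (Fin n × Fin n) (Fin n × Fin n) (Module.End ℂ H)) (p q : Fin n × Fin n) :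
    (toOp H (RMatrix n c x y) * M) p q = M p q + g c x y • M p.swap q := by
  simp only [Matrix.mul_apply, toOp, RMatrix, Matrix.map_apply, Matrix.add_apply,
    Matrix.smul_apply, permMatrix_apply, Matrix.one_apply, ← Algebra.smul_def, add_smul,
    Finset.sum_add_distrib, smul_eq_mul, mul_ite, mul_one, mul_zero, ite_smul, one_smul, zero_smul]
  congr 1
  · simp
  · rw [Finset.sum_eq_single p.swap]
    · simp
    · intro r _ hr
      exact if_neg fun h => hr (Prod.ext h.2.symm h.1.symm)
    · simp

theorem mul_toOp_RMatrix_apply {n : ℕ} (c x y : ℂ)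
    (M : Matrix (Fin n × Fin n) (Fin n × Fin n) (Module.End ℂ H)) (p q : Fin n × Fin n) :
    (M * toOp H (RMatrix n c x y)) p q = M p q + g c x y • M p q.swap := by
  simp only [Matrix.mul_apply, toOp, RMatrix, Matrix.map_apply, Matrix.add_apply,
    Matrix.smul_apply, permMatrix_apply, Matrix.one_apply, ← Algebra.commutes,
    ← Algebra.smul_def, add_smul,
    Finset.sum_add_distrib, smul_eq_mul, mul_ite, mul_one, mul_zero, ite_smul, one_smul, zero_smul]
  congr 1
  · simp
  · rw [Finset.sum_eq_single q.swap]
    · simp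
    · intro r _ hr
      exact if_neg fun h => hr (Prod.ext h.1 h.2)
    · simp

theorem SatisfiesRTT.apply {n : ℕ} {c : ℂ} {S : Set ℂ}
    {T : ℂ → Matrix (Fin n) (Fin n) (Module.End ℂ H)} (hRTT : SatisfiesRTT c S T) {x y : ℂ}
    (hx : x ∈ S) (hy : y ∈ S) (hne : x ≠ y) (i j k l : Fin n) :
    T x i j * T y k l + g c x y • (T x k j * T y i l) =
      T y k l * T x i j + g c x y • (T y k j * T x i l) := by
  have h := congrFun₂ (hRTT x hx y hy hne) (i, k) (j, l)
  have e1 : ∀ p q : Fin n × Fin n, ((T x ⊗ₖ (1 : Matrix (Fin n) (Fin n) (Module.End ℂ H))) *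
      ((1 : Matrix (Fin n) (Fin n) (Module.End ℂ H)) ⊗ₖ T y)) p q =
      T x p.1 q.1 * T y p.2 q.2 := by
    intro p q
    simp [Matrix.mul_apply, Fintype.sum_prod_type, Matrix.one_apply]
  have e2 : ∀ p q : Fin n × Fin n, (((1 : Matrix (Fin n) (Fin n) (Module.End ℂ H)) ⊗ₖ T y) *
      (T x ⊗ₖ (1 : Matrix (Fin n) (Fin n) (Module.End ℂ H)))) p q =
      T y p.2 q.2 * T x p.1 q.1 := by
    intro p q
    simp [Matrix.mul_apply, Fintype.sum_prod_type, Matrix.one_apply]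
  rw [mul_assoc, toOp_RMatrix_mul_apply, mul_toOp_RMatrix_apply, e1, e2, e1, e2] at h
  exact h

theorem smul_betheVector_swap (c : ℂ) {S : Set ℂ}
    {T : ℂ → Matrix (Fin 3) (Fin 3) (Module.End ℂ H)} (hRTT : SatisfiesRTT c S T)
    (vac : H) (u : Fin a → ℂ) (v : Fin b → ℂ) (hu : ∀ k, u k ∈ S)
    (huv : ∀ j k, v j ≠ u k) (i : ℕ) (hi : i + 1 < a)
    (hne : u ⟨i, Nat.lt_of_succ_lt hi⟩ ≠ u ⟨i + 1, hi⟩) :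
    (1 + g c (u ⟨i, Nat.lt_of_succ_lt hi⟩) (u ⟨i + 1, hi⟩)) • betheVector c T vac u v =
      (1 + g c (u ⟨i, Nat.lt_of_succ_lt hi⟩) (u ⟨i + 1, hi⟩)) • betheVector c T vac
        (u ∘ Equiv.swap (⟨i, Nat.lt_of_succ_lt hi⟩ : Fin a) ⟨i + 1, hi⟩) v := by
  have hF := exchangeVec_nestedVector c T vac u v i hi huv hne
  set t := g c (u ⟨i, Nat.lt_of_succ_lt hi⟩) (u ⟨i + 1, hi⟩) with ht
  set τ := Equiv.swap (⟨i, Nat.lt_of_succ_lt hi⟩ : Fin a) ⟨i + 1, hi⟩ with hτ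
  have key : ∀ β : Fin a → Fin 2,
      (1 + t) • (List.ofFn fun k : Fin a => rowB T (u k) (β k)).prod =
        (List.ofFn fun k : Fin a => rowB T ((u ∘ τ) k) ((β ∘ τ) k)).prod +
          t • (List.ofFn fun k : Fin a => rowB T ((u ∘ τ) k) (β k)).prod := by
    intro β
    apply smul_prod_ofFn (1 + t) t a i hi
    · simp only [Function.comp_apply, hτ, Equiv.swap_apply_left, Equiv.swap_apply_right, rowB]
      -- With both row indices equal to 0, the two terms on the left of RTT coincide, which produces
      -- the factor `1 + t`.
      have h := hRTT.apply (hu ⟨i, Nat.lt_of_succ_lt hi⟩) (hu ⟨i + 1, hi⟩) hne 0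
        (β ⟨i, Nat.lt_of_succ_lt hi⟩).succ 0 (β ⟨i + 1, hi⟩).succ
      rw [add_smul, one_smul, ht, h]
    · intro k h1 h2
      have h1' : k ≠ ⟨i, Nat.lt_of_succ_lt hi⟩ := fun h => h1 (congrArg Fin.val h)
      have h2' : k ≠ ⟨i + 1, hi⟩ := fun h => h2 (congrArg Fin.val h)
      simp [hτ, Equiv.swap_apply_of_ne_of_ne h1' h2']
  simp only [betheVector, Finset.smul_sum]
  simp only [← LinearMap.smul_apply, key, LinearMap.add_apply, Finset.sum_add_distrib]
  -- Reindexing `β` by the swap moves `P` from the row of operators onto the components `F`.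
  rw [← sum_comp_swap (⟨i, Nat.lt_of_succ_lt hi⟩ : Fin a) ⟨i + 1, hi⟩, ← hτ,
    ← Finset.sum_add_distrib]
  refine Finset.sum_congr rfl fun β _ => ?_
  have hβ : (β ∘ τ) ∘ τ = β := comp_swap_comp_swap _ _ β
  rw [hβ, LinearMap.smul_apply, LinearMap.smul_apply, ← map_smul, ← map_add, ← map_smul]
  exact congrArg _ (congrFun hF β)

theorem betheVector_swap (c : ℂ) {S : Set ℂ}
    {T : ℂ → Matrix (Fin 3) (Fin 3) (Module.End ℂ H)} (hRTT : SatisfiesRTT c S T)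
    (vac : H) (u : Fin a → ℂ) (v : Fin b → ℂ) (hu : ∀ k, u k ∈ S)
    (huv : ∀ j k, v j ≠ u k) (i : ℕ) (hi : i + 1 < a) :
    betheVector c T vac u v = betheVector c T vac
      (u ∘ Equiv.swap (⟨i, Nat.lt_of_succ_lt hi⟩ : Fin a) ⟨i + 1, hi⟩) v := by
  by_cases hne : u ⟨i, Nat.lt_of_succ_lt hi⟩ = u ⟨i + 1, hi⟩
  · congr 1
    funext k
    rw [Function.comp_apply, Equiv.swap_apply_def]
    split_ifs with h1 h2
    · rw [h1, hne]
    · rw [h2, hne]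
    · rfl
  -- When `t = -1` nothing can be cancelled; starting from the swapped parameters replaces `t` by
  -- `-t = 1`, and the factor becomes 2.
  by_cases h1 : 1 + g c (u ⟨i, Nat.lt_of_succ_lt hi⟩) (u ⟨i + 1, hi⟩) = 0
  · have h := smul_betheVector_swap c hRTT vac
      (u ∘ Equiv.swap (⟨i, Nat.lt_of_succ_lt hi⟩ : Fin a) ⟨i + 1, hi⟩) v
      (fun k => hu _) (fun j k => huv j _) i hi
      (by simpa using fun h : u ⟨i + 1, hi⟩ = _ => hne h.symm)
    rw [comp_swap_comp_swap] at h
    simp only [Function.comp_apply, Equiv.swap_apply_left, Equiv.swap_apply_right] at h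
    refine (smul_right_injective H ?_ h).symm
    have h2 : g c (u ⟨i + 1, hi⟩) (u ⟨i, Nat.lt_of_succ_lt hi⟩) =
        -g c (u ⟨i, Nat.lt_of_succ_lt hi⟩) (u ⟨i + 1, hi⟩) := by
      rw [g, g, ← neg_sub, div_neg]
    rw [h2, ← eq_neg_of_add_eq_zero_left h1]
    norm_num
  · exact smul_right_injective H h1 (smul_betheVector_swap c hRTT vac u v hu huv i hi hne)

theorem betheVector_perm (c : ℂ) {S : Set ℂ}
    {T : ℂ → Matrix (Fin 3) (Fin 3) (Module.End ℂ H)} (hRTT : SatisfiesRTT c S T)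
    (vac : H) (v : Fin b → ℂ) (σ : Equiv.Perm (Fin a)) (u : Fin a → ℂ) (hu : ∀ k, u k ∈ S)
    (huv : ∀ j k, v j ≠ u k) :
    betheVector c T vac u v = betheVector c T vac (u ∘ σ) v := by
  cases a with
  | zero => rw [Subsingleton.elim (u ∘ σ) u]
  | succ n =>
    have hσ : σ ∈ Submonoid.closure
        (Set.range fun i : Fin n => Equiv.swap i.castSucc i.succ) := by
      rw [Equiv.Perm.mclosure_swap_castSucc_succ]
      trivial
    -- `u` must vary: in a product, the second permutation acts on the already permuted family `u ∘
    -- x`.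
    induction hσ using Submonoid.closure_induction generalizing u with
    | mem τ hτ =>
      obtain ⟨i, rfl⟩ := hτ
      exact betheVector_swap c hRTT vac u v hu huv i.1 (by omega)
    | one => rfl
    | mul x y _ _ hx hy =>
      rw [hx u hu huv, hy (u ∘ x) (fun k => hu _) fun j k => huv j _]
      rfl

end BetheVector

end NestedBethe

theorem mainTheorem3 {H : Type*} [AddCommGroup H] [Module ℂ H]
    (c : ℂ) (S : Set ℂ) (T : ℂ → Matrix (Fin 3) (Fin 3) (Module.End ℂ H))
    (hRTT : NestedBethe.SatisfiesRTT c S T)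
    (lam : Fin 3 → ℂ → ℂ) (vac : H) (hvac : NestedBethe.IsVacuum S T lam vac)
    (a b : ℕ) (u : Fin a → ℂ) (v : Fin b → ℂ)
    (hu : ∀ k, u k ∈ S) (hv : ∀ j, v j ∈ S) (huv : ∀ j k, v j ≠ u k) :
    (∀ (i : ℕ) (hi : i + 1 < a),
      NestedBethe.betheVector c T vac u v =
        NestedBethe.betheVector c T vac
          (u ∘ Equiv.swap (⟨i, Nat.lt_of_succ_lt hi⟩ : Fin a) ⟨i + 1, hi⟩) v) ∧
    (∀ σ : Equiv.Perm (Fin a),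
      NestedBethe.betheVector c T vac u v = NestedBethe.betheVector c T vac (u ∘ σ) v) := by
  exact ⟨fun i hi => NestedBethe.betheVector_swap c hRTT vac u v hu huv i hi,
    fun σ => NestedBethe.betheVector_perm c hRTT vac v σ u hu huv⟩
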